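/- **Setting.** Let $0<\alpha\le 1$, $0<\beta\le 1$, $B>0$, $0<\lambda<1$, $d>0$ and $D\in\mathbb R$. A (closed) Lyapunov surface with radius $d$ is a nonempty compact set $G\subset\mathbb R^3$ with a field of unit normals $\nu$ such that 1. at each $m\in G$ the plane through $m$ orthogonal to $\nu(m)$ is tangent to $G$; 2. the angle between $\nu(m_1)$ and $\nu(m_2)$ is at most $A_0|m_1-m_2|^{\kappa}$ for all $m_1,m_2\in G$, with some constants $A_0>0$, $0<\kappa\le 1$; 3. for each $m\in G$, a straight line parallel to $\nu(m)$ meets $G$ in at most one point inside the ball of radius $d$ about $m$. Let $L_1(B,\beta)=L_1(B,\beta;d,D)$ be the class of all such surfaces that have diameter at most $D$ and for which, at every $m\in G$, there are Cartesian coordinates $(\chi,\eta,\zeta)$ with origin $m$ and $\zeta$-axis along $\nu(m)$, and a function $F$ that is differentiable on the disc $\chi^2+\eta^2<d^2$ with $|\nabla F(x)-\nabla F(y)|\le B|x-y|^\beta$ there, such that inside the ball of radius $d$ about $m$ the surface has the equation $\zeta=F(\chi,\eta)$. Let $|\cdot|$ denote surface area, and let $H_\alpha(1)$ be the class of all $f:G\to\mathbb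 R$ with $|f(x)-f(y)|\le|x-y|^\alpha$ for $x,y\in G$. For $t\in G$ put $$Jf(t)=\iint_G\frac{f(\tau)\,dS_\tau}{|\tau-t|^{2\lambda}} .$$ For a family $\Psi_2$ of surfaces, consider cubature formulas which on each $G\in\Psi_2$ use nodes $M_k=M_k(G)\in G$ and weights $p_k=p_k(G,\cdot)$, $k=1,\dots,n$: $$Jf(t)=\sum_{k=1}^n p_k(t)f(M_k)+R_n(f,G,t).$$ The error of the formula is $R_n(\Psi_1,\Psi_2)=\sup|R_n(f,G,t)|$ over all $G\in\Psi_2$, $f\in\Psi_1=H_\alpha(1)$ on $G$, and $t\in G$; $\zeta_n[\Psi_1,\Psi_2]$ is the infimum of the errors over all choices of nodes $M_k(G)\in G$ and weights $p_k(G,t)$. A division of $G$ with constant $c>0$ consists of measurable sets $g_1,\dots,g_n$ with union $G$, whose pairwise intersections have zero area, with $c^{-1}|G|/n\le|g_k|\le c|G|/n$ and $\operatorname{diam}g_k\le c\,(|G|/n)^{1/2}$. For a division of each $G\in\Psi_2$ and arbitrary points $M_k\in g_k$ (for example centres of the $g_k$), consider the rule $$Jf(t)=\sum_{k=1}^n f(M_k)\iint_{g_k}\frac{dS_\tau}{|\tau-t|^{2\lambda}}+R_n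 .\tag{7.3}$$ **Theorem 7.1.** (i) Each $G\in L_1(B,\beta;d,D)$ has finite positive area, and the integrals $Jf(t)$, $f\in H_\alpha(1)$, $t\in G$, converge absolutely. (ii) There is $c_0>0$, depending only on the parameters $B,\beta,d,D$ of the class (and possibly on $\alpha,\lambda$), such that every $G\in L_1(B,\beta;d,D)$ has, for every $n\ge1$, a division into $n$ parts with constant $c_0$. (iii) For every $c>0$ there are positive constants $a,A,K$, depending only on $\alpha,\beta,\lambda,B,d,D,c$, such that for every nonempty family $\Psi_2\subseteq L_1(B,\beta;d,D)$ (a single surface or the whole class, for example), every $n\ge1$, all divisions with constant $c$ of the surfaces in $\Psi_2$ into $n$ parts, and all points $M_k\in g_k$, the rule (7.3) has error $$a\,n^{-\alpha/2}\le R_n(\Psi_1,\Psi_2)\le A\,n^{-\alpha/2},$$ and it is optimal with respect to order among all formulas that use $n$ values of $f$: $$\zeta_n[\Psi_1,\Psi_2]\le R_n(\Psi_1,\Psi_2)\le K\,\zeta_n[\Psi_1,\Psi_2].$$ -/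

import Mathlib

open MeasureTheory
open scoped NNReal ENNReal MeasureTheory

noncomputable section

namespace WeaklySingular

/-- Euclidean space `ℝ³`. -/
abbrev E3 := EuclideanSpace ℝ (Fin 3)

/-- The Euclidean plane `ℝ²` (the plane of the local coordinates `χ, η`). -/
abbrev E2 := EuclideanSpace ℝ (Fin 2)

/-- Surface area on subsets of `ℝ³`: the two-dimensional Hausdorff measure, normalized so that it
is Lebesgue measure on planes. -/
def areaMeasure : Measure E3 := μHE[2]

/-- The area `|G|` of a surface, as a real number. -/
def area (G : Set E3) : ℝ := (areaMeasure G).toReal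

/-- The three Lyapunov conditions for the closed surface `S` with unit normal field `ν`;
`d` is the radius in the third condition. -/
structure IsLyapunovSurface (S : Set E3) (ν : E3 → E3) (d : ℝ) : Prop where
  isCompact : IsCompact S
  nonempty : S.Nonempty
  unit_normal : ∀ m ∈ S, ‖ν m‖ = 1
  /-- At each point `m` the plane through `m` orthogonal to `ν m` is tangent to `S`. -/
  tangent : ∀ m ∈ S,
    (fun y : E3 => inner ℝ (ν m) (y - m)) =o[nhdsWithin m S] (fun y : E3 => y - m)
  /-- The angle between two normals is at most `A r ^ κ`, where `r` is the distance of the points.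
  (Since `A` is any constant, `≤` and `<` are equivalent for distinct points.) -/
  angle_le : ∃ A κ : ℝ, 0 < A ∧ 0 < κ ∧ κ ≤ 1 ∧ ∀ m₁ ∈ S, ∀ m₂ ∈ S,
    InnerProductGeometry.angle (ν m₁) (ν m₂) ≤ A * dist m₁ m₂ ^ κ
  radius_pos : 0 < d
  /-- A straight line parallel to the normal at `m` meets `S` in at most one point inside the
  ball of radius `d` about `m`. -/
  line : ∀ m ∈ S, ∀ x ∈ S ∩ Metric.ball m d, ∀ y ∈ S ∩ Metric.ball m d,
    (∃ s : ℝ, y = x + s • ν m) → x = y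

/-- The class `W¹_β(B)` on a set `U` of the plane: `F` is differentiable at the points of `U` and
its derivative satisfies the Hölder condition with constant `B` and exponent `β` there. -/
def HolderC1On (B β : ℝ≥0) (F : E2 → ℝ) (U : Set E2) : Prop :=
  (∀ x ∈ U, DifferentiableAt ℝ F x) ∧ HolderOnWith B β (fderiv ℝ F) U

/-- The Lyapunov surfaces of class `L₁(B, β)` with Lyapunov radius `d` and diameter at most `D`.
At every point `m` of `S` there are Cartesian coordinates `(χ, η, ζ)` with origin `m` whose
`ζ`-axis is directed along the normal at `m`, such that inside the ball of radius `d` about `m`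
the surface has the equation `ζ = F (χ, η)`, with `F` in `W¹_β(B)`. -/
def lyapunovClass (B β : ℝ≥0) (d D : ℝ) : Set (Set E3) :=
  {S | (∃ ν : E3 → E3, IsLyapunovSurface S ν d ∧
      ∀ m ∈ S, ∃ (e : OrthonormalBasis (Fin 3) ℝ E3) (F : E2 → ℝ),
        e 2 = ν m ∧ HolderC1On B β F (Metric.ball 0 d) ∧
        ∀ x ∈ Metric.ball m d,
          x ∈ S ↔ inner ℝ (e 2) (x - m)
            = F !₂[inner ℝ (e 0) (x - m), inner ℝ (e 1) (x - m)]) ∧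
    Metric.diam S ≤ D}

/-- The class `H_α(1)` of functions on the surface `G`. (The values outside `G` play no role.) -/
def holderClass (α : ℝ≥0) (G : Set E3) : Set (E3 → ℝ) :=
  {f | HolderOnWith 1 α f G}

/-- The weakly singular kernel
`((τ₁ - t₁)² + (τ₂ - t₂)² + (τ₃ - t₃)²) ^ (-lam)`. -/
def kernel (lam : ℝ) (t τ : E3) : ℝ :=
  1 / ((τ 0 - t 0) ^ 2 + (τ 1 - t 1) ^ 2 + (τ 2 - t 2) ^ 2) ^ lam

/-- The weakly singular integral `J f (t)` over the surface `G`. -/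
def J (lam : ℝ) (G : Set E3) (f : E3 → ℝ) (t : E3) : ℝ :=
  ∫ τ in G, f τ * kernel lam t τ ∂areaMeasure

/-- The remainder `R_n(f, G, M_k, p_k, t)` of the cubature formula
`J f (t) = ∑ k, p_k(t) f(M_k) + R_n`. -/
def remainder (lam : ℝ) (G : Set E3) {n : ℕ} (M : Fin n → E3) (p : Fin n → E3 → ℝ)
    (f : E3 → ℝ) (t : E3) : ℝ :=
  J lam G f t - ∑ k, p k t * f (M k)

/-- The error `R_n(Ψ₁, Ψ₂, M, p)` of a cubature formula on the classes `Ψ₁ = H_α(1)` and `Ψ₂`: the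
supremum of `|R_n(f, G, M_k, p_k, t)|` over all `G ∈ Ψ₂`, `f ∈ H_α(1)` and `t ∈ G`. The nodes
`M G k` and the weights `p G k` are those which the formula uses on the surface `G`. -/
def classError (α : ℝ≥0) (lam : ℝ) (Ψ₂ : Set (Set E3)) {n : ℕ}
    (M : Set E3 → Fin n → E3) (p : Set E3 → Fin n → E3 → ℝ) : ℝ≥0∞ :=
  ⨆ G ∈ Ψ₂, ⨆ f ∈ holderClass α G, ⨆ t ∈ G,
    ENNReal.ofReal |remainder lam G (M G) (p G) f t|

/-- `ζ_n[Ψ₁, Ψ₂]`: the infimum of the errors of all cubature formulas that use `n` values of `f`,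
with arbitrary nodes on the surface and arbitrary weights (functions of `t`). -/
def optimalError (α : ℝ≥0) (lam : ℝ) (Ψ₂ : Set (Set E3)) (n : ℕ) : ℝ≥0∞ :=
  ⨅ (M : Set E3 → Fin n → E3) (p : Set E3 → Fin n → E3 → ℝ)
    (_ : ∀ G ∈ Ψ₂, ∀ k, M G k ∈ G), classError α lam Ψ₂ M p

/-- A division of the surface `G` into `n` parts `g k`, overlapping in sets of zero area at most,
each of area of order `|G| / n` and of diameter of order at most `√(|G| / n)`; `c` is the constant
in these relations. -/
structure IsDivision (c : ℝ) (G : Set E3) {n : ℕ} (g : Fin n → Set E3) : Prop where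
  measurable : ∀ k, MeasurableSet (g k)
  iUnion_eq : ⋃ k, g k = G
  aedisjoint : Pairwise fun i j => AEDisjoint areaMeasure (g i) (g j)
  le_area : ∀ k, c⁻¹ * (area G / n) ≤ area (g k)
  area_le : ∀ k, area (g k) ≤ c * (area G / n)
  diam_le : ∀ k, Metric.diam (g k) ≤ c * √(area G / n)

/-- The exact weights: the integral of the kernel over the patches. -/
def patchWeights (lam : ℝ) {n : ℕ} (g : Fin n → Set E3) (k : Fin n) (t : E3) : ℝ :=
  ∫ τ in g k, kernel lam t τ ∂areaMeasure

end WeaklySingular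

end

open WeaklySingular

/-!
The only geometric fact needed about the class `L₁(B, β)` is that its surfaces are Ahlfors regular
of dimension two with common constants (`exists_isRegularSurface`): balls of radius `r` contain
area of order `r ^ 2`. In the ball of radius `d` about a point `m` the surface is the graph of a
function `F`; tangency of the plane orthogonal to the normal forces `F 0 = 0` and `∇F 0 = 0`
(`graph_origin`), so the Hölder condition makes `F` Lipschitz with constant `B * d ^ β`. The
projection to the plane and the parametrization of the graph are then Lipschitz, which compares the
surface area with the area of discs. Compactness of balls of `ℝ³` turns the local upper bound into
a bound of the whole area.

* Divisions: the cells of a net of scale `√(|G| / n)` have area at least `|G| / n`. A rounding of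
  the ratios (`exists_rounding`) tells how many parts each cell has to provide, and cells can be cut
  into parts of exactly equal area, since surface area vanishes on points (`exists_equipartition`).
* Upper bound: summing over dyadic shells, `∫ |τ - t| ^ (-2λ)` over `G` is bounded uniformly, as
  `2λ < 2` (`exists_lintegral_kernel_le`), and on each patch `|f τ - f (M k)|` is at most the power
  `α` of the diameter of the patch, which is of order `n ^ (-1/2)`.
* Lower bound, for any nodes and weights: `f = dist(·, nodes) ^ α` lies in `H_α(1)` and vanishes at
  the nodes, so its remainder is `J f t`. By regularity, balls of radius a small multiple of
  `n ^ (-1/2)` about the nodes cover at most half of `G`, whence `J f t` is at least of order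
  `n ^ (-α/2)` (`exists_le_classError`).

Since the lower bound holds for every formula and the upper bound for the rule with exact weights,
the rule is optimal in order.
-/

namespace WeaklySingular

open Metric Set Filter Topology

/-! ### Area under Lipschitz maps -/

section HausdorffLipschitz

variable {X Y : Type*} [EMetricSpace X] [MeasurableSpace X] [BorelSpace X]
  [EMetricSpace Y] [MeasurableSpace Y] [BorelSpace Y]

lemma euclideanHausdorffMeasure_image_le {f : X → Y} {s : Set X} {K : ℝ≥0}
    (hf : LipschitzOnWith K f s) (k : ℕ) :
    (μHE[k] : Measure Y) (f '' s) ≤ (K : ℝ≥0∞) ^ k * (μHE[k] : Measure X) s := by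
  have h := hf.hausdorffMeasure_image_le (d := k) (Nat.cast_nonneg k)
  rw [ENNReal.rpow_natCast] at h
  simp only [Measure.euclideanHausdorffMeasure_def, Measure.smul_apply]
  rw [mul_smul_comm]
  gcongr

end HausdorffLipschitz

instance : NullSingletonClass areaMeasure := by
  have h := Measure.nullSingletonClass_hausdorff E3 (d := ((2 : ℕ) : ℝ)) (by norm_num)
  refine ⟨fun x => ?_⟩
  simp [areaMeasure, Measure.euclideanHausdorffMeasure_def]

/-! ### Local graph representation -/

/-- Projection to the first two Cartesian coordinates with origin `m` and axes `e`. -/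
noncomputable def planeProj (e : OrthonormalBasis (Fin 3) ℝ E3) (m y : E3) : E2 :=
  !₂[inner ℝ (e 0) (y - m), inner ℝ (e 1) (y - m)]

/-- The point with Cartesian coordinates `(x₀, x₁, F x)` in the frame with origin `m` and
axes `e`. -/
noncomputable def graphMap (e : OrthonormalBasis (Fin 3) ℝ E3) (m : E3) (F : E2 → ℝ) (x : E2) : E3 :=
  m + e.repr.symm !₂[x 0, x 1, F x]

section Graph

variable (e : OrthonormalBasis (Fin 3) ℝ E3) (m : E3) (F : E2 → ℝ)

lemma inner_graphMap (x : E2) (i : Fin 3) :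
    inner ℝ (e i) (graphMap e m F x - m) = (!₂[x 0, x 1, F x] : E3) i := by
  rw [← e.repr_apply_apply]
  simp [graphMap]

lemma planeProj_graphMap (x : E2) : planeProj e m (graphMap e m F x) = x := by
  ext i
  fin_cases i <;> simp [planeProj, inner_graphMap]

lemma graphMap_planeProj {y : E3}
    (hy : inner ℝ (e 2) (y - m) = F (planeProj e m y)) :
    graphMap e m F (planeProj e m y) = y := by
  have : e.repr.symm !₂[planeProj e m y 0, planeProj e m y 1, F (planeProj e m y)] = y - m := by
    rw [LinearIsometryEquiv.symm_apply_eq]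
    ext i
    rw [e.repr_apply_apply]
    fin_cases i
    · simp [planeProj]
    · simp [planeProj]
    · simpa using hy.symm
  simp [graphMap, this]

lemma dist_planeProj_le (y z : E3) : dist (planeProj e m y) (planeProj e m z) ≤ dist y z := by
  have h : dist y z = dist (e.repr (y - m)) (e.repr (z - m)) := by
    rw [e.repr.dist_map, dist_sub_right]
  rw [h, EuclideanSpace.dist_eq, EuclideanSpace.dist_eq, Fin.sum_univ_three, Fin.sum_univ_two]
  apply Real.sqrt_le_sqrt
  simp only [e.repr_apply_apply, planeProj]
  simp

lemma dist_graphMap_le (x y : E2) :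
    dist (graphMap e m F x) (graphMap e m F y) ≤ dist x y + dist (F x) (F y) := by
  have h : dist (graphMap e m F x) (graphMap e m F y)
      = dist (!₂[x 0, x 1, F x] : E3) !₂[y 0, y 1, F y] := by
    rw [graphMap, graphMap, dist_add_left, LinearIsometryEquiv.dist_map]
  rw [h, EuclideanSpace.dist_eq, EuclideanSpace.dist_eq, Fin.sum_univ_three, Fin.sum_univ_two]
  simp only [Matrix.cons_val]
  refine (Real.sqrt_le_sqrt (y := _ ^ 2) ?_).trans_eq (Real.sqrt_sq (by positivity))
  have hs := Real.sq_sqrt (x := dist (x 0) (y 0) ^ 2 + dist (x 1) (y 1) ^ 2) (by positivity)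
  nlinarith [Real.sqrt_nonneg (dist (x 0) (y 0) ^ 2 + dist (x 1) (y 1) ^ 2),
    dist_nonneg (x := F x) (y := F y),
    mul_nonneg (Real.sqrt_nonneg (dist (x 0) (y 0) ^ 2 + dist (x 1) (y 1) ^ 2))
    (dist_nonneg (x := F x) (y := F y))]

lemma planeProj_self : planeProj e m m = 0 := by
  ext i
  fin_cases i <;> simp [planeProj]

variable {e m F} {S : Set E3} {d : ℝ}

/-- At the origin of the frame a graph that is tangent to the plane `ζ = 0` passes through the
origin and has zero gradient there. -/
lemma graph_origin (hd : 0 < d) (hm : m ∈ S)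
    (hF : ∀ x ∈ ball (0 : E2) d, DifferentiableAt ℝ F x)
    (hS : ∀ x ∈ ball m d, x ∈ S ↔ inner ℝ (e 2) (x - m) = F (planeProj e m x))
    (htan : (fun y : E3 => inner ℝ (e 2) (y - m)) =o[𝓝[S] m] (fun y : E3 => y - m)) :
    F 0 = 0 ∧ fderiv ℝ F 0 = 0 := by
  have h0 : F 0 = 0 := by
    have := (hS m (mem_ball_self hd)).1 hm
    simpa [planeProj_self] using this.symm
  refine ⟨h0, ?_⟩
  have hdiff : DifferentiableAt ℝ F 0 := hF 0 (mem_ball_self hd)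
  have hzero : graphMap e m F 0 = m := by
    have := graphMap_planeProj e m F (y := m) (by simpa [planeProj_self] using h0.symm)
    rwa [planeProj_self] at this
  have hcont : Tendsto (graphMap e m F) (𝓝 0) (𝓝 m) := by
    have hF0 : Tendsto F (𝓝 0) (𝓝 (F 0)) := hdiff.continuousAt
    rw [tendsto_iff_dist_tendsto_zero] at hF0 ⊢
    have hid : Tendsto (fun x : E2 => dist x 0) (𝓝 0) (𝓝 0) :=
      tendsto_iff_dist_tendsto_zero.1 tendsto_id
    refine squeeze_zero (fun _ => dist_nonneg) (fun x => ?_) (by simpa using hid.add hF0)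
    have h := dist_graphMap_le e m F x 0
    rwa [hzero, dist_zero_right] at h
  have hcontS : Tendsto (graphMap e m F) (𝓝 0) (𝓝[S] m) := by
    refine tendsto_nhdsWithin_iff.2 ⟨hcont, ?_⟩
    filter_upwards [hcont (ball_mem_nhds m hd)] with x hx
    rw [hS _ hx, inner_graphMap, planeProj_graphMap]
    simp
  have hO : (fun x : E2 => graphMap e m F x - m) =O[𝓝 0] (fun x : E2 => x) := by
    have hFO : (fun x : E2 => F x) =O[𝓝 0] (fun x : E2 => x) := by
      simpa [h0] using hdiff.isBigO_sub
    have h1 : (fun x : E2 => ‖x‖ + ‖F x‖) =O[𝓝 0] (fun x : E2 => x) :=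
      (Asymptotics.isBigO_refl _ _).norm_left.add hFO.norm_left
    refine (Asymptotics.isBigO_of_le _ fun x => ?_).trans h1
    have := dist_graphMap_le e m F x 0
    rw [hzero, h0, dist_eq_norm, dist_zero_right, dist_zero_right] at this
    exact this.trans (le_abs_self _)
  have ho : (fun x : E2 => F x) =o[𝓝 0] (fun x : E2 => x) := by
    refine ((htan.comp_tendsto hcontS).trans_isBigO hO).congr_left fun x => ?_
    simp [inner_graphMap]
  have : HasFDerivAt F (0 : E2 →L[ℝ] ℝ) 0 := by
    rw [hasFDerivAt_iff_isLittleO]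
    simpa [h0] using ho
  exact this.fderiv

/-- The parametrization of the graph is Lipschitz with constant `1 + L`. -/
lemma graph_area_le {L : ℝ≥0} (hL : LipschitzOnWith L F (ball 0 d))
    (hS : ∀ x ∈ ball m d, x ∈ S ↔ inner ℝ (e 2) (x - m) = F (planeProj e m x))
    {r : ℝ} (hr0 : 0 ≤ r) (hr : r ≤ d) :
    areaMeasure (S ∩ ball m r) ≤ ENNReal.ofReal (Real.pi * (1 + L) ^ 2 * r ^ 2) := by
  have hsub : S ∩ ball m r ⊆ graphMap e m F '' ball 0 r := by
    rintro y ⟨hyS, hyr⟩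
    refine ⟨planeProj e m y, ?_, graphMap_planeProj e m F
      ((hS y (ball_subset_ball hr hyr)).1 hyS)⟩
    have := dist_planeProj_le e m y m
    rw [planeProj_self] at this
    exact this.trans_lt hyr
  have hlip : LipschitzOnWith (1 + L) (graphMap e m F) (ball 0 r) := by
    refine LipschitzOnWith.of_dist_le_mul fun x hx y hy => ?_
    have h1 := dist_graphMap_le e m F x y
    have h2 := hL.dist_le_mul x (ball_subset_ball hr hx) y (ball_subset_ball hr hy)
    push_cast
    linarith
  refine (measure_mono hsub).trans ((euclideanHausdorffMeasure_image_le hlip 2).trans_eq ?_)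
  rw [EuclideanSpace.euclideanHausdorffMeasure_eq_volume, EuclideanSpace.volume_ball_fin_two,
    ← ENNReal.ofReal_coe_nnreal, ← ENNReal.ofReal_pow (by positivity),
    ← ENNReal.ofReal_pow hr0,
    ← ENNReal.ofReal_mul (by positivity), ← ENNReal.ofReal_mul (by positivity)]
  congr 1
  push_cast
  ring

/-- The projection is `1`-Lipschitz, and maps the graph in a ball of radius `r` onto a set that
contains the disc of radius `r / (1 + L)`. -/
lemma le_graph_area {L : ℝ≥0} (hd : 0 < d) (hL : LipschitzOnWith L F (ball 0 d))
    (hF0 : F 0 = 0)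
    (hS : ∀ x ∈ ball m d, x ∈ S ↔ inner ℝ (e 2) (x - m) = F (planeProj e m x))
    {r : ℝ} (hr0 : 0 ≤ r) (hr : r ≤ d) :
    ENNReal.ofReal (Real.pi / (1 + L) ^ 2 * r ^ 2) ≤ areaMeasure (S ∩ ball m r) := by
  have hL1 : (0 : ℝ) < 1 + L := by positivity
  have hsub : ball (0 : E2) (r / (1 + L)) ⊆ planeProj e m '' (S ∩ ball m r) := by
    intro x hx
    have hxd : x ∈ ball (0 : E2) d := by
      refine ball_subset_ball ((div_le_self hr0 ?_).trans hr) hx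
      simp
    have hzero : graphMap e m F 0 = m := by
      have := graphMap_planeProj e m F (y := m) (by simpa [planeProj_self] using hF0.symm)
      rwa [planeProj_self] at this
    have hmem : graphMap e m F x ∈ ball m r := by
      rw [mem_ball]
      calc dist (graphMap e m F x) m = dist (graphMap e m F x) (graphMap e m F 0) := by rw [hzero]
        _ ≤ dist x 0 + dist (F x) (F 0) := dist_graphMap_le e m F x 0
        _ ≤ dist x 0 + L * dist x 0 := by
          gcongr; exact hL.dist_le_mul x hxd 0 (mem_ball_self hd)
        _ = dist x 0 * (1 + L) := by ring
        _ < r := (lt_div_iff₀ hL1).1 hx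
    refine ⟨graphMap e m F x, ⟨?_, hmem⟩, planeProj_graphMap e m F x⟩
    rw [hS _ (ball_subset_ball hr hmem), inner_graphMap, planeProj_graphMap]
    simp
  have hlip : LipschitzOnWith 1 (planeProj e m) (S ∩ ball m r) :=
    LipschitzOnWith.of_dist_le_mul fun x _ y _ => by simpa using dist_planeProj_le e m x y
  have h := (measure_mono hsub).trans (euclideanHausdorffMeasure_image_le hlip 2)
  rw [EuclideanSpace.euclideanHausdorffMeasure_eq_volume, EuclideanSpace.volume_ball_fin_two] at h
  simp only [ENNReal.coe_one, one_pow, one_mul] at h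
  refine le_trans (le_of_eq ?_) h
  rw [← ENNReal.ofReal_pow (by positivity),
    ← ENNReal.ofReal_mul (by positivity)]
  congr 1
  field_simp

end Graph

/-! ### Uniform regularity of the class -/

/-- Two-dimensional Ahlfors regularity of a compact surface: a ball of radius `r` about any point
of space contains area at most `C * r ^ 2`, and a ball of radius `r ≤ d` about a point of the
surface contains area at least `c * r ^ 2`. -/
structure IsRegularSurface (c C d D : ℝ) (G : Set E3) : Prop where
  isCompact : IsCompact G
  nonempty : G.Nonempty
  diam_le : diam G ≤ D
  le_area : ∀ m ∈ G, ∀ r, 0 < r → r ≤ d → ENNReal.ofReal (c * r ^ 2) ≤ areaMeasure (G ∩ ball m r)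
  area_le : ∀ x r, 0 < r → areaMeasure (G ∩ ball x r) ≤ ENNReal.ofReal (C * r ^ 2)

/-- A bound of the area in small balls about points of a set of bounded diameter gives a bound of
the whole area, because a ball of `ℝ³` is covered by a fixed number of small balls. -/
lemma exists_area_le (d D C : ℝ) (hd : 0 < d) (hC : 0 ≤ C) :
    ∃ A : ℝ, 0 ≤ A ∧ ∀ G : Set E3, IsCompact G → G.Nonempty → diam G ≤ D →
      (∀ m ∈ G, areaMeasure (G ∩ ball m d) ≤ ENNReal.ofReal C) →
      areaMeasure G ≤ ENNReal.ofReal A := by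
  obtain ⟨T, hTf, hT⟩ := (totallyBounded_iff.1
    (isCompact_closedBall (0 : E3) D).totallyBounded) (d / 2) (by positivity)
  lift T to Finset E3 using hTf
  refine ⟨T.card * C, by positivity, fun G hG hne hD h => ?_⟩
  obtain ⟨m₀, hm₀⟩ := hne
  have hcov : G ⊆ ⋃ y ∈ T, G ∩ ball (m₀ + y) (d / 2) := by
    intro x hx
    have : x - m₀ ∈ closedBall (0 : E3) D := by
      rw [mem_closedBall_zero_iff, ← dist_eq_norm]
      exact (dist_le_diam_of_mem hG.isBounded hx hm₀).trans hD
    obtain ⟨y, hy, hxy⟩ := mem_iUnion₂.1 (hT this)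
    refine mem_iUnion₂.2 ⟨y, hy, hx, ?_⟩
    rw [mem_ball, dist_eq_norm] at hxy ⊢
    rwa [← sub_sub]
  calc areaMeasure G ≤ ∑ y ∈ T, areaMeasure (G ∩ ball (m₀ + y) (d / 2)) :=
        (measure_mono hcov).trans (measure_biUnion_finset_le _ _)
    _ ≤ ∑ _y ∈ T, ENNReal.ofReal C := by
        refine Finset.sum_le_sum fun y _ => ?_
        rcases (G ∩ ball (m₀ + y) (d / 2)).eq_empty_or_nonempty with h0 | ⟨m, hmG, hm⟩
        · simp [h0]
        · refine (measure_mono ?_).trans (h m hmG)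
          refine inter_subset_inter_right _ (ball_subset_ball' ?_)
          rw [dist_comm]
          linarith [mem_ball.1 hm]
    _ = ENNReal.ofReal (T.card * C) := by
        rw [Finset.sum_const, nsmul_eq_mul, ENNReal.ofReal_mul (by positivity),
          ENNReal.ofReal_natCast]

/-- The surfaces of the class are Ahlfors regular with common constants: inside the ball of
radius `d` each is a graph over a plane with gradient at most `B * d ^ β`. -/
lemma exists_isRegularSurface (B β : ℝ≥0) (d D : ℝ) (hd : 0 < d) :
    ∃ c C : ℝ, 0 < c ∧ 0 < C ∧ ∀ G ∈ lyapunovClass B β d D, IsRegularSurface c C d |D| G := by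
  set L : ℝ≥0 := B * d.toNNReal ^ (β : ℝ)
  have hloc : ∀ G ∈ lyapunovClass B β d D, ∀ m ∈ G, ∀ r, 0 < r → r ≤ d →
      ENNReal.ofReal (Real.pi / (1 + L) ^ 2 * r ^ 2) ≤ areaMeasure (G ∩ ball m r) ∧
      areaMeasure (G ∩ ball m r) ≤ ENNReal.ofReal (Real.pi * (1 + L) ^ 2 * r ^ 2) := by
    rintro G ⟨⟨ν, hν, hloc⟩, -⟩ m hm r hr0 hr
    obtain ⟨e, F, he, ⟨hFd, hFh⟩, hS⟩ := hloc m hm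
    obtain ⟨hF0, hF'⟩ := graph_origin hd hm hFd hS (by simpa [he] using hν.tangent m hm)
    have hL : LipschitzOnWith L F (ball 0 d) := by
      refine Convex.lipschitzOnWith_of_nnnorm_fderiv_le hFd (fun x hx => ?_) (convex_ball 0 d)
      have h1 := hFh.nndist_le_of_le hx (mem_ball_self hd) (d := d.toNNReal) (by
        rw [← NNReal.coe_le_coe, coe_nndist, Real.coe_toNNReal _ hd.le]
        exact (mem_ball.1 hx).le)
      rwa [hF', nndist_zero_right] at h1
    exact ⟨le_graph_area hd hL hF0 hS hr0.le hr, graph_area_le hL hS hr0.le hr⟩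
  obtain ⟨A, hA0, hA⟩ := exists_area_le d D (Real.pi * (1 + L) ^ 2 * d ^ 2) hd (by positivity)
  refine ⟨Real.pi / (1 + L) ^ 2, 4 * (Real.pi * (1 + L) ^ 2) + 4 * A / d ^ 2,
    by positivity, by positivity, fun G hG => ?_⟩
  have hcomp : IsCompact G := by obtain ⟨⟨ν, hν, -⟩, -⟩ := hG; exact hν.isCompact
  have hne : G.Nonempty := by obtain ⟨⟨ν, hν, -⟩, -⟩ := hG; exact hν.nonempty
  refine ⟨hcomp, hne, hG.2.trans (le_abs_self D), fun m hm r hr0 hr => (hloc G hG m hm r hr0 hr).1,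
    fun x r hr0 => ?_⟩
  rcases (G ∩ ball x r).eq_empty_or_nonempty with h0 | ⟨m, hmG, hm⟩
  · simp [h0]
  rcases le_or_gt (2 * r) d with hrd | hrd
  · -- the ball about `x` lies in the ball of twice the radius about a point of the surface
    have hsub : G ∩ ball x r ⊆ G ∩ ball m (2 * r) := by
      refine inter_subset_inter_right _ (ball_subset_ball' ?_)
      rw [dist_comm]
      linarith [mem_ball.1 hm]
    refine ((measure_mono hsub).trans (hloc G hG m hmG _ (by positivity) hrd).2).trans
      (ENNReal.ofReal_le_ofReal ?_)
    have : 0 ≤ 4 * A / d ^ 2 * r ^ 2 := by positivity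
    linarith
  · refine ((measure_mono inter_subset_left).trans (hA G hcomp hne hG.2 fun m hm =>
      (hloc G hG m hm d hd le_rfl).2)).trans (ENNReal.ofReal_le_ofReal ?_)
    have h1 : A ≤ 4 * A / d ^ 2 * r ^ 2 := by
      rw [div_mul_eq_mul_div, le_div_iff₀ (by positivity)]
      nlinarith [mul_nonneg hA0 (show 0 ≤ (2 * r) ^ 2 - d ^ 2 by nlinarith)]
    have : 0 ≤ 4 * (Real.pi * (1 + L) ^ 2) * r ^ 2 := by positivity
    linarith

/-! ### Equipartitions for a measure without point masses -/

section Equipartition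

variable {X : Type*} [MeasurableSpace X] [StandardBorelSpace X] {μ : Measure X}
  [IsFiniteMeasure μ] [NullSingletonClass μ]

/-- A finite measure that vanishes on points takes all intermediate values: embed the space
measurably into the unit interval, where the distribution function of the image measure is
continuous. -/
lemma exists_measurableSet_subset_real_eq {A : Set X} (hA : MeasurableSet A) {a : ℝ}
    (ha0 : 0 ≤ a) (ha : a ≤ μ.real A) :
    ∃ B ⊆ A, MeasurableSet B ∧ μ.real B = a := by
  -- the sigmoid keeps the values positive, so that the intervals `(0, b]` exhaust the image
  set φ : X → ℝ := fun x => (unitInterval.sigmoid (embeddingReal X x) : ℝ) with hφ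
  have hφm : MeasurableEmbedding φ :=
    (MeasurableEmbedding.subtype_coe measurableSet_Icc).comp
      (measurableEmbedding_sigmoid_comp_embeddingReal X)
  set ν : Measure ℝ := (μ.restrict A).map φ with hν
  have : NullSingletonClass ν := ⟨fun x => by
    rw [hν, hφm.map_apply]
    exact (Set.subsingleton_singleton.preimage hφm.injective).measure_zero _⟩
  have hν' : ∀ b, ν.real (Ioc 0 b) = μ.real (A ∩ φ ⁻¹' Ioc 0 b) := fun b => by
    rw [measureReal_def, hν, hφm.map_apply,
      Measure.restrict_apply (hφm.measurable measurableSet_Ioc), inter_comm, measureReal_def]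
  have hcont : ContinuousOn (fun b : ℝ => ∫ _ in (0 : ℝ)..b, (1 : ℝ) ∂ν) (Icc 0 1) :=
    (intervalIntegral.continuous_primitive (fun a b => intervalIntegrable_const) 0).continuousOn
  have hval : ∀ b, 0 ≤ b → ∫ _ in (0 : ℝ)..b, (1 : ℝ) ∂ν = μ.real (A ∩ φ ⁻¹' Ioc 0 b) := by
    intro b hb
    rw [intervalIntegral.integral_of_le hb, ← hν']
    simp
  have hone : μ.real (A ∩ φ ⁻¹' Ioc 0 1) = μ.real A := by
    congr 1
    refine inter_eq_left.2 fun x _ => ?_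
    exact ⟨by rw [hφ]; exact Real.sigmoid_pos _, (unitInterval.sigmoid _).2.2⟩
  have hmem : a ∈ Icc (∫ _ in (0 : ℝ)..0, (1 : ℝ) ∂ν) (∫ _ in (0 : ℝ)..1, (1 : ℝ) ∂ν) := by
    rw [hval 1 zero_le_one, hone]
    simpa using ⟨ha0, ha⟩
  obtain ⟨b, hb, hba⟩ := intermediate_value_Icc zero_le_one hcont hmem
  refine ⟨A ∩ φ ⁻¹' Ioc 0 b, inter_subset_left, hA.inter (hφm.measurable measurableSet_Ioc), ?_⟩
  rw [← hval b hb.1]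
  exact hba

lemma exists_equipartition {n : ℕ} (hn : 1 ≤ n) {A : Set X} (hA : MeasurableSet A) {w : ℝ}
    (hw : 0 ≤ w) (h : μ.real A = n * w) :
    ∃ g : Fin n → Set X, (∀ k, MeasurableSet (g k)) ∧ ⋃ k, g k = A ∧
      Pairwise (fun i j => Disjoint (g i) (g j)) ∧ ∀ k, μ.real (g k) = w := by
  induction n, hn using Nat.le_induction generalizing A with
  | base =>
    refine ⟨fun _ => A, fun _ => hA, iUnion_const A, fun i j hij => ?_, fun _ => by simpa using h⟩
    exact (hij (by lia)).elim
  | succ n hn ih =>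
    obtain ⟨B, hBA, hBm, hB⟩ := exists_measurableSet_subset_real_eq (μ := μ) hA hw (by
      rw [h]
      push_cast
      nlinarith [mul_nonneg (Nat.cast_nonneg (α := ℝ) n) hw])
    obtain ⟨g, hgm, hgU, hgd, hgw⟩ := ih (hA.diff hBm) (by
      rw [measureReal_sdiff hBA hBm, h, hB]
      push_cast
      ring)
    have hdisj : ∀ k, Disjoint B (g k) := fun k =>
      disjoint_sdiff_right.mono_right ((subset_iUnion g k).trans hgU.le)
    refine ⟨Fin.cons B g, ?_, ?_, ?_, ?_⟩
    · intro k
      refine Fin.cases ?_ (fun k => ?_) k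
      · simpa using hBm
      · simpa using hgm k
    · rw [← union_sdiff_cancel hBA, ← hgU]
      ext x
      simp
    · intro i j
      refine Fin.cases ?_ (fun i => ?_) i <;> refine Fin.cases ?_ (fun j => ?_) j
      · simp
      · intro _
        simpa using hdisj j
      · intro _
        simpa using (hdisj i).symm
      · intro hij
        simpa using hgd fun h => hij (by rw [h])
    · intro k
      refine Fin.cases ?_ (fun k => ?_) k
      · simpa using hB
      · simpa using hgw k

end Equipartition

/-! ### Cells of a separated net -/

/-- A compact set splits into finitely many cells, each of which contains the part of the set in
the ball of radius `ε` about its centre and lies in the closed ball of radius `2 * ε`: the centres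
form a maximal set with distances greater than `2 * ε`. -/
lemma exists_cells {X : Type*} [MetricSpace X] [MeasurableSpace X] [BorelSpace X] {G : Set X}
    (hG : IsCompact G) {ε : ℝ} (hε : 0 < ε) :
    ∃ (N : ℕ) (x : Fin N → X) (C : Fin N → Set X), (∀ j, x j ∈ G) ∧
      (∀ j, MeasurableSet (C j)) ∧ ⋃ j, C j = G ∧ Pairwise (fun i j => Disjoint (C i) (C j)) ∧
      (∀ j, G ∩ ball (x j) ε ⊆ C j) ∧ ∀ j, C j ⊆ closedBall (x j) (2 * ε) := by
  lift ε to ℝ≥0 using hε.le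
  have hε0 : ε ≠ 0 := by
    rintro rfl
    simp at hε
  have hpack : packingNumber (2 * ε) G ≠ ⊤ := by
    obtain ⟨T, -, hTf, hT⟩ := exists_finite_isCover_of_isCompact hε0 hG
    refine ne_top_of_le_ne_top hTf.encard_lt_top.ne
      ((packingNumber_two_mul_le_externalCoveringNumber ε G).trans ?_)
    exact hT.externalCoveringNumber_le_encard
  set S := maximalSeparatedSet (2 * ε) G
  have hSf : S.Finite := by
    rw [← encard_ne_top_iff, encard_maximalSeparatedSet hpack]
    exact hpack
  have : Fintype S := hSf.fintype
  set σ := (Fintype.equivFin S).symm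
  set x : Fin (Fintype.card S) → X := fun j => σ j
  have hxG : ∀ j, x j ∈ G := fun j => maximalSeparatedSet_subset (σ j).2
  have hsep : ∀ i j, i ≠ j → 2 * (ε : ℝ) < dist (x i) (x j) := by
    intro i j hij
    have h := isSeparated_maximalSeparatedSet (σ i).2 (σ j).2
      (fun h => hij (σ.injective (Subtype.ext h)))
    beta_reduce at h
    rw [edist_nndist, ENNReal.coe_lt_coe, ← NNReal.coe_lt_coe, coe_nndist] at h
    exact_mod_cast h
  have hcov : ∀ y ∈ G, ∃ j, y ∈ closedBall (x j) (2 * ε) := by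
    intro y hy
    obtain ⟨z, hz, hyz⟩ := mem_iUnion₂.1
      ((isCover_maximalSeparatedSet hpack).subset_iUnion_closedBall hy)
    exact ⟨σ.symm ⟨z, hz⟩, by simpa [x] using hyz⟩
  have hball : ∀ i j y, y ∈ ball (x i) ε → y ∈ ball (x j) ε → i = j := by
    intro i j y hi hj
    by_contra hij
    have := dist_triangle_left (x i) (x j) y
    linarith [hsep i j hij, mem_ball.1 hi, mem_ball.1 hj]
  -- before the sets are made disjoint, the small balls about the other centres are removed
  set E : Fin (Fintype.card S) → Set X :=
    fun j => (G ∩ closedBall (x j) (2 * ε)) \ ⋃ i ∈ {i | i ≠ j}, ball (x i) ε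
  have hEball : ∀ j, G ∩ ball (x j) ε ⊆ E j := by
    rintro j y ⟨hyG, hyj⟩
    refine ⟨⟨hyG, (ball_subset_closedBall.trans (closedBall_subset_closedBall ?_)) hyj⟩, ?_⟩
    · linarith
    · simp only [mem_iUnion, not_exists]
      exact fun i hi hyi => hi (hball i j y hyi hyj)
  have hEm : ∀ j, MeasurableSet (E j) := fun j =>
    (hG.measurableSet.inter isClosed_closedBall.measurableSet).diff
      (MeasurableSet.biUnion (to_countable _) fun i _ => isOpen_ball.measurableSet)
  refine ⟨Fintype.card S, x, disjointed E, hxG, fun j => ?_, ?_, disjoint_disjointed E, ?_, ?_⟩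
  · rw [disjointed_apply, Finset.sup_eq_iSup]
    exact (hEm j).diff (MeasurableSet.biUnion (to_countable _) fun i _ => hEm i)
  · rw [iUnion_disjointed]
    refine Subset.antisymm (iUnion_subset fun j => fun y hy => hy.1.1) fun y hy => ?_
    by_cases h : ∃ j, y ∈ ball (x j) ε
    · obtain ⟨j, hj⟩ := h
      exact mem_iUnion.2 ⟨j, hEball j ⟨hy, hj⟩⟩
    · obtain ⟨j, hj⟩ := hcov y hy
      refine mem_iUnion.2 ⟨j, ⟨hy, hj⟩, ?_⟩
      simp only [mem_iUnion, not_exists]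
      exact fun i _ hi => h ⟨i, hi⟩
  · rintro j y hy
    rw [disjointed_apply, Finset.sup_eq_iSup]
    refine ⟨hEball j hy, ?_⟩
    simp only [iSup_eq_iUnion, mem_iUnion, not_exists, Finset.mem_Iio]
    rintro i hi ⟨-, hyi⟩
    exact hyi (mem_iUnion₂.2 ⟨j, hi.ne', hy.2⟩)
  · exact fun j y hy => (disjointed_subset E j hy).1.2

/-- Real numbers `b i ≥ 1` with an integral sum can be rounded to positive integers with the same
sum: take the increments of the integral parts of the partial sums. -/
lemma exists_rounding {ι : Type*} (s : Finset ι) (b : ι → ℝ) (hb : ∀ i ∈ s, 1 ≤ b i) :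
    ∃ k : ι → ℕ, ((∑ i ∈ s, k i : ℕ) : ℤ) = ⌊∑ i ∈ s, b i⌋ ∧
      ∀ i ∈ s, 1 ≤ k i ∧ (k i : ℝ) ≤ 2 * b i ∧ b i ≤ 2 * k i := by
  classical
  induction s using Finset.induction_on with
  | empty => exact ⟨fun _ => 0, by simp⟩
  | insert a s has ih =>
    obtain ⟨k, hk, hkb⟩ := ih fun i hi => hb i (Finset.mem_insert_of_mem hi)
    have hba := hb a (Finset.mem_insert_self a s)
    set t := ∑ i ∈ s, b i
    have h1 : (⌊t⌋ : ℝ) ≤ t := Int.floor_le t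
    have h2 : t < ⌊t⌋ + 1 := Int.lt_floor_add_one t
    have h3 : (⌊b a + t⌋ : ℝ) ≤ b a + t := Int.floor_le _
    have h4 : b a + t < ⌊b a + t⌋ + 1 := Int.lt_floor_add_one _
    have hpos : 1 ≤ ⌊b a + t⌋ - ⌊t⌋ := by
      have : ⌊t⌋ + 1 ≤ ⌊b a + t⌋ := Int.le_floor.2 (by push_cast; linarith)
      linarith
    obtain ⟨p, hp⟩ := Int.eq_ofNat_of_zero_le (zero_le_one.trans hpos)
    have hpR : (p : ℝ) = ⌊b a + t⌋ - ⌊t⌋ := by exact_mod_cast hp.symm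
    have hp1 : 1 ≤ p := by omega
    have hp1R : (1 : ℝ) ≤ p := by exact_mod_cast hp1
    have hne : ∀ i ∈ s, i ≠ a := fun i hi h => has (h ▸ hi)
    refine ⟨Function.update k a p, ?_, fun i hi => ?_⟩
    · rw [Finset.sum_insert has, Finset.sum_insert has, Function.update_self,
        Finset.sum_congr rfl fun i hi => Function.update_of_ne (hne i hi) _ _]
      push_cast at hk ⊢
      linarith
    · rcases Finset.mem_insert.1 hi with rfl | hi
      · rw [Function.update_self]
        exact ⟨hp1, by linarith, by linarith⟩
      · rw [Function.update_of_ne (hne i hi)]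
        exact hkb i hi


/-! ### Divisions of regular surfaces -/

/-- Cells of area at least `|G| / n` can be cut into `n` parts of comparable area: a cell is cut
into parts of equal area, as many as the rounded ratio of its area to `|G| / n`. -/
lemma exists_isDivision_of_cells {G : Set E3} (hb : Bornology.IsBounded G)
    (hG0 : 0 < area G) (hG : areaMeasure G ≠ ⊤) {n : ℕ} (hn : 1 ≤ n) {c₀ : ℝ} (hc₀ : 2 ≤ c₀)
    {N : ℕ} {C : Fin N → Set E3} (hCm : ∀ j, MeasurableSet (C j)) (hCU : ⋃ j, C j = G)
    (hCd : Pairwise fun i j => Disjoint (C i) (C j)) (hCa : ∀ j, area G / n ≤ area (C j))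
    (hCdiam : ∀ j, diam (C j) ≤ c₀ * √(area G / n)) :
    ∃ g : Fin n → Set E3, IsDivision c₀ G g := by
  have hn0 : (0 : ℝ) < n := by exact_mod_cast hn
  set w := area G / n with hw
  have hw0 : 0 < w := by positivity
  set μ := areaMeasure.restrict G with hμ
  have : Fact (areaMeasure G < ⊤) := ⟨hG.lt_top⟩
  have hμA : ∀ A, MeasurableSet A → A ⊆ G → μ.real A = area A := fun A hA hAG => by
    rw [hμ, measureReal_restrict_apply hA, inter_eq_left.2 hAG]
    rfl
  have hCG : ∀ j, C j ⊆ G := fun j => (subset_iUnion C j).trans hCU.le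
  have hsum : ∑ j, area (C j) = area G := by
    rw [← hμA G (hCU ▸ MeasurableSet.iUnion hCm) Subset.rfl]
    conv_rhs => rw [← hCU]
    rw [measureReal_iUnion_fintype hCd hCm]
    exact Finset.sum_congr rfl fun j _ => (hμA _ (hCm j) (hCG j)).symm
  obtain ⟨k, hk, hkb⟩ := exists_rounding Finset.univ (fun j => area (C j) / w)
    fun j _ => (one_le_div hw0).2 (hCa j)
  have hkn : ∑ j, k j = n := by
    rw [← Finset.sum_div, hsum, hw, div_div_cancel₀ hG0.ne', Int.floor_natCast] at hk
    exact_mod_cast hk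
  have hkpos : ∀ j, (0 : ℝ) < k j := fun j => by exact_mod_cast (hkb j (Finset.mem_univ j)).1
  have hparts : ∀ j, ∃ g : Fin (k j) → Set E3, (∀ i, MeasurableSet (g i)) ∧ ⋃ i, g i = C j ∧
      Pairwise (fun i i' => Disjoint (g i) (g i')) ∧ ∀ i, μ.real (g i) = area (C j) / k j :=
    fun j => exists_equipartition (hkb j (Finset.mem_univ j)).1 (hCm j)
      (div_nonneg ENNReal.toReal_nonneg (hkpos j).le) (by
        rw [hμA _ (hCm j) (hCG j), mul_div_cancel₀ _ (hkpos j).ne'])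
  choose g hgm hgU hgd hga using hparts
  have hgC : ∀ j i, g j i ⊆ C j := fun j i => (subset_iUnion (g j) i).trans (hgU j).le
  have hgarea : ∀ j i, area (g j i) = area (C j) / k j := fun j i => by
    rw [← hga j i, hμA _ (hgm j i) ((hgC j i).trans (hCG j))]
  have hdisj : ∀ p q : (Σ j, Fin (k j)), p ≠ q → Disjoint (g p.1 p.2) (g q.1 q.2) := by
    rintro ⟨j, i⟩ ⟨j', i'⟩ h
    by_cases hj : j = j'
    · subst hj
      exact hgd j fun hi => h (congrArg (Sigma.mk j) hi)
    · exact (hCd hj).mono (hgC j i) (hgC j' i')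
  set σ : (Σ j, Fin (k j)) ≃ Fin n := finSigmaFinEquiv.trans (finCongr hkn)
  refine ⟨fun i => g (σ.symm i).1 (σ.symm i).2, ⟨fun i => hgm _ _, ?_, ?_, ?_, ?_, ?_⟩⟩
  · rw [σ.symm.surjective.iUnion_comp (fun p => g p.1 p.2), iUnion_sigma]
    simp_rw [hgU, hCU]
  · exact fun i j hij => (hdisj _ _ (σ.symm.injective.ne hij)).aedisjoint
  · intro i
    set j := (σ.symm i).1
    obtain ⟨-, h, -⟩ := hkb j (Finset.mem_univ j)
    rw [hgarea, le_div_iff₀ (hkpos j)]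
    rw [← mul_div_assoc, le_div_iff₀ hw0] at h
    calc c₀⁻¹ * w * k j ≤ 2⁻¹ * w * k j := by gcongr
      _ ≤ area (C j) := by linarith
  · intro i
    set j := (σ.symm i).1
    obtain ⟨-, -, h⟩ := hkb j (Finset.mem_univ j)
    rw [hgarea, div_le_iff₀ (hkpos j)]
    rw [div_le_iff₀ hw0] at h
    calc area (C j) ≤ 2 * k j * w := h
      _ = 2 * w * k j := by ring
      _ ≤ c₀ * w * k j := by gcongr
  · exact fun i => (diam_mono (hgC _ _) (hb.subset (hCG _))).trans (hCdiam _)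

namespace IsRegularSurface

variable {c C d D : ℝ} {G : Set E3}

lemma area_lt_top (hG : IsRegularSurface c C d D G) : areaMeasure G < ⊤ := by
  obtain ⟨x, -⟩ := hG.nonempty
  obtain ⟨r, hr, hGr⟩ := hG.isCompact.isBounded.subset_ball_lt 0 x
  rw [← inter_eq_left.2 hGr]
  exact (hG.area_le x r hr).trans_lt ENNReal.ofReal_lt_top

lemma le_area_univ (hG : IsRegularSurface c C d D G) (hd : 0 < d) :
    c * d ^ 2 ≤ area G := by
  obtain ⟨m, hm⟩ := hG.nonempty
  have h := (hG.le_area m hm d hd le_rfl).trans (measure_mono inter_subset_left)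
  rwa [ENNReal.ofReal_le_iff_le_toReal hG.area_lt_top.ne] at h

lemma area_univ_le (hG : IsRegularSurface c C d D G) (hC : 0 < C) :
    area G ≤ C * (D + 1) ^ 2 := by
  obtain ⟨m, hm⟩ := hG.nonempty
  have hD : 0 ≤ D := diam_nonneg.trans hG.diam_le
  have hsub : G ⊆ ball m (D + 1) := fun x hx => by
    have := (dist_le_diam_of_mem hG.isCompact.isBounded hx hm).trans hG.diam_le
    rw [mem_ball]
    linarith
  have h := hG.area_le m (D + 1) (by positivity)
  rw [inter_eq_left.2 hsub] at h
  exact ENNReal.toReal_le_of_le_ofReal (by positivity) h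

/-- If `√(|G| / n)` is at most of order `d`, a net of that scale gives cells of area at least
`|G| / n`; otherwise `n` is bounded and the whole surface serves as a single cell. -/
lemma exists_isDivision (hG : IsRegularSurface c C d D G) (hc : 0 < c) (hd : 0 < d) {n : ℕ}
    (hn : 1 ≤ n) :
    ∃ g : Fin n → Set E3, IsDivision (2 + 4 / √c + D / (d * √c)) G g := by
  have hA : 0 < area G := lt_of_lt_of_le (by positivity) (hG.le_area_univ hd)
  have hb := hG.isCompact.isBounded
  have hsc : 0 < √c := Real.sqrt_pos.2 hc
  have hn0 : (1 : ℝ) ≤ n := by exact_mod_cast hn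
  have h1 : 0 ≤ 4 / √c := by positivity
  have hD : 0 ≤ D := diam_nonneg.trans hG.diam_le
  have h2 : 0 ≤ D / (d * √c) := by positivity
  set w := area G / n with hw
  have hw0 : 0 < w := by positivity
  have hsw : 0 < √w := Real.sqrt_pos.2 hw0
  set ε := √w / √c with hε
  have hε0 : 0 < ε := by positivity
  rcases le_or_gt ε d with hεd | hεd
  · obtain ⟨N, x, K, hxG, hKm, hKU, hKd, hKin, hKout⟩ := exists_cells hG.isCompact hε0
    have hKG : ∀ j, K j ⊆ G := fun j => (subset_iUnion K j).trans hKU.le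
    refine exists_isDivision_of_cells hb hA hG.area_lt_top.ne hn (by linarith) hKm hKU hKd
      (fun j => ?_) fun j => ?_
    · have h := (hG.le_area _ (hxG j) ε hε0 hεd).trans (measure_mono (hKin j))
      rw [ENNReal.ofReal_le_iff_le_toReal (measure_mono (hKG j) |>.trans_lt hG.area_lt_top).ne]
        at h
      refine le_trans (le_of_eq ?_) h
      rw [hε, div_pow, Real.sq_sqrt hw0.le, Real.sq_sqrt hc.le, mul_div_cancel₀ _ hc.ne']
    · calc diam (K j) ≤ 2 * (2 * ε) :=
            (diam_mono (hKout j) isBounded_closedBall).trans (diam_closedBall (by positivity))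
        _ = 4 / √c * √w := by rw [hε]; ring
        _ ≤ _ := by gcongr; linarith
  · refine exists_isDivision_of_cells (N := 1) (C := fun _ => G) hb hA hG.area_lt_top.ne hn
      (by linarith) (fun _ => hG.isCompact.measurableSet) (iUnion_const G)
      (fun i j hij => (hij (by lia)).elim) (fun _ => div_le_self hA.le hn0) fun _ => ?_
    rw [hε, lt_div_iff₀ hsc] at hεd
    calc diam G ≤ D := hG.diam_le
      _ = D / (d * √c) * (d * √c) := by field_simp
      _ ≤ D / (d * √c) * √w := by gcongr
      _ ≤ _ := by gcongr; linarith

end IsRegularSurface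

/-! ### The weakly singular kernel -/

lemma kernel_eq (lam : ℝ) (t τ : E3) : kernel lam t τ = 1 / (dist τ t ^ 2) ^ lam := by
  rw [kernel, EuclideanSpace.dist_eq, Real.sq_sqrt (by positivity), Fin.sum_univ_three]
  simp only [Real.dist_eq, sq_abs]

lemma kernel_nonneg (lam : ℝ) (t τ : E3) : 0 ≤ kernel lam t τ := by
  rw [kernel_eq]
  positivity

lemma measurable_kernel (lam : ℝ) (t : E3) : Measurable (kernel lam t) := by
  unfold kernel
  fun_prop

lemma kernel_le {lam r : ℝ} (hlam : 0 ≤ lam) (hr : 0 < r) {t τ : E3} (h : r ≤ dist τ t) :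
    kernel lam t τ ≤ 1 / (r ^ 2) ^ lam := by
  rw [kernel_eq]
  gcongr

lemma le_kernel {lam r : ℝ} (hlam : 0 ≤ lam) {t τ : E3} (hne : τ ≠ t) (h : dist τ t ≤ r) :
    1 / (r ^ 2) ^ lam ≤ kernel lam t τ := by
  rw [kernel_eq]
  have := dist_pos.2 hne
  gcongr

/-- The integral of the kernel against a measure whose balls about the pole have mass `O(r ^ 2)`
is bounded in terms of the constants only: it is at most a geometric series over the dyadic
spherical shells about the pole, with ratio `(1 / 4) ^ (1 - lam)`. -/
lemma exists_lintegral_kernel_le {lam : ℝ} (hlam₀ : 0 < lam) (hlam₁ : lam < 1) {C R : ℝ}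
    (hC : 0 < C) (hR : 0 < R) :
    ∃ K : ℝ, 0 < K ∧ ∀ (μ : Measure E3) (t : E3),
      (∀ r, 0 < r → μ (ball t r) ≤ ENNReal.ofReal (C * r ^ 2)) →
      (∀ᵐ τ ∂μ, dist τ t ≤ R) →
      ∫⁻ τ, ENNReal.ofReal (kernel lam t τ) ∂μ ≤ ENNReal.ofReal K := by
  set q : ℝ := 1 / 2 with hq
  have hq0 : 0 < q := by positivity
  have hq1 : q < 1 := by norm_num [hq]
  set a : ℕ → ℝ := fun i => 1 / ((R * q ^ (i + 1)) ^ 2) ^ lam with ha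
  have ha0 : ∀ i, 0 < a i := fun i => by positivity
  set ρ : ℝ := (q ^ 2) ^ (1 - lam) with hρ
  have hρ1 : ρ < 1 := Real.rpow_lt_one (by positivity) (by norm_num [hq]) (by linarith)
  have hterm : ∀ i, a i * (C * (2 * (R * q ^ i)) ^ 2)
      = 4 * C * R ^ 2 / ((R * q) ^ 2) ^ lam * ρ ^ i := fun i => by
    have h1 : ((R * q ^ (i + 1)) ^ 2) ^ lam = ((R * q) ^ 2) ^ lam * ((q ^ 2) ^ lam) ^ i := by
      rw [Real.rpow_pow_comm (by positivity), ← Real.mul_rpow (by positivity) (by positivity)]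
      ring_nf
    have h2 : ρ ^ i = (q ^ 2) ^ i / ((q ^ 2) ^ lam) ^ i := by
      rw [hρ, Real.rpow_sub (by positivity), Real.rpow_one, div_pow]
    have hX : 0 < ((R * q) ^ 2) ^ lam := by positivity
    have hY : 0 < (q ^ 2) ^ lam := by positivity
    simp only [ha]
    rw [h1, h2]
    generalize ((R * q) ^ 2) ^ lam = x at hX
    generalize (q ^ 2) ^ lam = y at hY
    field_simp
    ring_nf
  have hsum : Summable fun i => a i * (C * (2 * (R * q ^ i)) ^ 2) := by
    simp_rw [hterm]
    exact (summable_geometric_of_lt_one (by positivity) hρ1).mul_left _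
  refine ⟨∑' i, a i * (C * (2 * (R * q ^ i)) ^ 2),
    hsum.tsum_pos (fun i => mul_nonneg (ha0 i).le (by positivity)) 0
      (mul_pos (ha0 0) (by positivity)), fun μ t hμ hdist => ?_⟩
  rw [ENNReal.ofReal_tsum_of_nonneg (fun i => mul_nonneg (ha0 i).le (by positivity)) hsum]
  have hpt : ∀ᵐ τ ∂μ, ENNReal.ofReal (kernel lam t τ) ≤
      ∑' i, (ball t (2 * (R * q ^ i))).indicator (fun _ => ENNReal.ofReal (a i)) τ := by
    filter_upwards [hdist] with τ hτ
    rcases eq_or_ne τ t with rfl | hne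
    -- at the pole the kernel takes the value `1 / 0 = 0`
    · have : kernel lam τ τ = 0 := by
        rw [kernel_eq]
        simp [Real.zero_rpow hlam₀.ne']
      simp [this]
    · obtain ⟨i, hi1, hi2⟩ := exists_nat_pow_near_of_lt_one (x := dist τ t / R)
        (div_pos (dist_pos.2 hne) hR) ((div_le_one hR).2 hτ) hq0 hq1
      rw [lt_div_iff₀ hR] at hi1
      rw [div_le_iff₀ hR] at hi2
      refine le_trans ?_ (ENNReal.le_tsum i)
      have hpos : 0 < R * q ^ i := by positivity
      rw [indicator_of_mem (by rw [mem_ball]; linarith)]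
      exact ENNReal.ofReal_le_ofReal (kernel_le hlam₀.le (by positivity) (by linarith))
  calc ∫⁻ τ, ENNReal.ofReal (kernel lam t τ) ∂μ
      ≤ ∫⁻ τ, ∑' i, (ball t (2 * (R * q ^ i))).indicator (fun _ => ENNReal.ofReal (a i)) τ ∂μ :=
        lintegral_mono_ae hpt
    _ = ∑' i, ∫⁻ τ, (ball t (2 * (R * q ^ i))).indicator (fun _ => ENNReal.ofReal (a i)) τ ∂μ :=
        lintegral_tsum fun i => (measurable_const.indicator measurableSet_ball).aemeasurable
    _ ≤ ∑' i, ENNReal.ofReal (a i * (C * (2 * (R * q ^ i)) ^ 2)) := by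
        refine ENNReal.tsum_le_tsum fun i => ?_
        rw [lintegral_indicator_const measurableSet_ball, ENNReal.ofReal_mul (ha0 i).le]
        gcongr
        exact hμ _ (by positivity)

/-! ### The integral over a regular surface -/

lemma exists_integral_kernel_le {lam : ℝ} (hlam₀ : 0 < lam) (hlam₁ : lam < 1) {c C d D : ℝ}
    (hC : 0 < C) (hD : 0 ≤ D) :
    ∃ K : ℝ, 0 < K ∧ ∀ G, IsRegularSurface c C d D G → ∀ t ∈ G,
      IntegrableOn (kernel lam t) G areaMeasure ∧
      ∫ τ in G, kernel lam t τ ∂areaMeasure ≤ K := by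
  obtain ⟨K, hK0, hK⟩ := exists_lintegral_kernel_le hlam₀ hlam₁ hC (R := D + 1) (by positivity)
  refine ⟨K, hK0, fun G hG t ht => ?_⟩
  have h := hK (areaMeasure.restrict G) t (fun r hr => by
    rw [Measure.restrict_apply measurableSet_ball, inter_comm]
    exact hG.area_le t r hr) (by
    filter_upwards [ae_restrict_mem hG.isCompact.measurableSet] with τ hτ
    linarith [(dist_le_diam_of_mem hG.isCompact.isBounded hτ ht).trans hG.diam_le])
  have hnn : 0 ≤ᵐ[areaMeasure.restrict G] kernel lam t := ae_of_all _ (kernel_nonneg lam t)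
  have hm := (measurable_kernel lam t).aestronglyMeasurable (μ := areaMeasure.restrict G)
  refine ⟨⟨hm, (hasFiniteIntegral_iff_ofReal hnn).2 (h.trans_lt ENNReal.ofReal_lt_top)⟩, ?_⟩
  rw [integral_eq_lintegral_of_nonneg_ae hnn hm]
  exact ENNReal.toReal_le_of_le_ofReal hK0.le h

lemma integrableOn_mul_kernel {lam : ℝ} {α : ℝ≥0} (hα : 0 < α) {G : Set E3} (hG : IsCompact G)
    {f : E3 → ℝ} (hf : f ∈ holderClass α G) {t : E3}
    (hk : IntegrableOn (kernel lam t) G areaMeasure) :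
    IntegrableOn (fun τ => f τ * kernel lam t τ) G areaMeasure := by
  have hcont : ContinuousOn f G := HolderOnWith.continuousOn hf hα
  obtain ⟨M, hM⟩ := hG.exists_bound_of_continuousOn hcont
  refine Integrable.bdd_mul (c := M) hk (hcont.aestronglyMeasurable hG.measurableSet) ?_
  filter_upwards [ae_restrict_mem hG.measurableSet] with τ hτ using hM τ hτ

/-! ### Upper bound of the error -/

/-- With the exact weights the remainder is the sum over the patches of the integrals of
`f τ - f (M k)` against the kernel. -/
lemma abs_remainder_patchWeights_le {lam : ℝ} {α : ℝ≥0} (hα : 0 < α) {G : Set E3}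
    (hG : IsCompact G) {f : E3 → ℝ} (hf : f ∈ holderClass α G) {t : E3}
    (hk : IntegrableOn (kernel lam t) G areaMeasure) {n : ℕ} {g : Fin n → Set E3}
    (hgm : ∀ i, MeasurableSet (g i)) (hgU : ⋃ i, g i = G)
    (hgd : Pairwise fun i j => AEDisjoint areaMeasure (g i) (g j)) {δ : ℝ}
    (hδ : ∀ i, diam (g i) ≤ δ) {M : Fin n → E3} (hM : ∀ i, M i ∈ g i) :
    |remainder lam G M (patchWeights lam g) f t|
      ≤ δ ^ (α : ℝ) * ∫ τ in G, kernel lam t τ ∂areaMeasure := by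
  have hgG : ∀ i, g i ⊆ G := fun i => (subset_iUnion g i).trans hgU.le
  have hsplit : ∀ φ : E3 → ℝ, IntegrableOn φ G areaMeasure →
      ∫ τ in G, φ τ ∂areaMeasure = ∑ i, ∫ τ in g i, φ τ ∂areaMeasure := fun φ hφ => by
    have h := integral_iUnion_ae (μ := areaMeasure) (f := φ)
      (fun i => (hgm i).nullMeasurableSet) hgd (hgU.symm ▸ hφ)
    rwa [hgU, tsum_fintype] at h
  have hfk := integrableOn_mul_kernel hα hG hf hk
  rw [remainder, J, hsplit _ hfk, hsplit _ hk, ← Finset.sum_sub_distrib, Finset.mul_sum]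
  refine (Finset.abs_sum_le_sum_abs _ _).trans (Finset.sum_le_sum fun i _ => ?_)
  have hki := hk.mono_set (hgG i)
  rw [patchWeights, mul_comm _ (f (M i)), ← integral_const_mul,
    ← integral_sub (hfk.mono_set (hgG i)) (hki.const_mul _), ← integral_const_mul,
    ← Real.norm_eq_abs]
  refine norm_integral_le_of_norm_le (hki.const_mul _) ?_
  filter_upwards [ae_restrict_mem (hgm i)] with τ hτ
  rw [← sub_mul, norm_mul, Real.norm_of_nonneg (kernel_nonneg lam t τ)]
  refine mul_le_mul_of_nonneg_right ?_ (kernel_nonneg lam t τ)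
  have h := HolderOnWith.dist_le hf (hgG i hτ) (hgG i (hM i))
  rw [NNReal.coe_one, one_mul, dist_eq_norm] at h
  refine h.trans (Real.rpow_le_rpow dist_nonneg ?_ α.coe_nonneg)
  exact (dist_le_diam_of_mem (hG.isBounded.subset (hgG i)) hτ (hM i)).trans (hδ i)

lemma div_sqrt_rpow {x n : ℝ} (hx : 0 ≤ x) (hn : 0 < n) (α : ℝ) :
    (x / √n) ^ α = x ^ α * n ^ (-α / 2) := by
  rw [Real.div_rpow hx (Real.sqrt_nonneg n), Real.sqrt_eq_rpow, ← Real.rpow_mul hn.le,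
    div_eq_mul_inv, ← Real.rpow_neg hn.le]
  ring_nf

/-- The rule with exact weights has error `O(n ^ (-α / 2))` for every division with constant
`c₀`, since `diam (g k)` is of order `n ^ (-1 / 2)`. -/
lemma exists_classError_le {lam : ℝ} (hlam₀ : 0 < lam) (hlam₁ : lam < 1) {α : ℝ≥0} (hα : 0 < α)
    {c C d D : ℝ} (hC : 0 < C) (hD : 0 ≤ D) {c₀ : ℝ} (hc₀ : 0 < c₀) :
    ∃ A : ℝ, 0 < A ∧ ∀ Ψ : Set (Set E3), (∀ G ∈ Ψ, IsRegularSurface c C d D G) →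
      ∀ n : ℕ, 1 ≤ n → ∀ (g : Set E3 → Fin n → Set E3) (M : Set E3 → Fin n → E3),
        (∀ G ∈ Ψ, IsDivision c₀ G (g G) ∧ ∀ k, M G k ∈ g G k) →
        classError α lam Ψ M (fun G => patchWeights lam (g G))
          ≤ ENNReal.ofReal (A * (n : ℝ) ^ (-(α : ℝ) / 2)) := by
  obtain ⟨K, hK0, hK⟩ := exists_integral_kernel_le (c := c) (d := d) hlam₀ hlam₁ hC hD
  refine ⟨(c₀ * √(C * (D + 1) ^ 2)) ^ (α : ℝ) * K, by positivity, fun Ψ hΨ n hn g M hg => ?_⟩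
  have hn0 : (0 : ℝ) < n := by exact_mod_cast hn
  refine iSup₂_le fun G hG => iSup₂_le fun f hf => iSup₂_le fun t ht =>
    ENNReal.ofReal_le_ofReal ?_
  have hGr := hΨ G hG
  obtain ⟨hdiv, hM⟩ := hg G hG
  obtain ⟨hk, hkK⟩ := hK G hGr t ht
  refine (abs_remainder_patchWeights_le hα hGr.isCompact hf hk hdiv.measurable hdiv.iUnion_eq
    hdiv.aedisjoint (δ := c₀ * √(C * (D + 1) ^ 2) / √n) (fun i => ?_) hM).trans ?_
  · refine (hdiv.diam_le i).trans ?_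
    rw [mul_div_assoc, ← Real.sqrt_div (by positivity)]
    gcongr
    exact hGr.area_univ_le hC
  · rw [div_sqrt_rpow (by positivity) hn0]
    calc _ ≤ (c₀ * √(C * (D + 1) ^ 2)) ^ (α : ℝ) * (n : ℝ) ^ (-(α : ℝ) / 2) * K := by gcongr
      _ = _ := by ring

/-! ### Lower bound of the error of every formula -/

/-- Powers `α ≤ 1` of the distance to a set belong to the class `H_α(1)`. -/
lemma infDist_rpow_mem_holderClass {α : ℝ≥0} (hα : α ≤ 1) {s : Set E3} (G : Set E3) :
    (fun τ => infDist τ s ^ (α : ℝ)) ∈ holderClass α G := by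
  have key : ∀ x y : E3, infDist x s ^ (α : ℝ) - infDist y s ^ (α : ℝ) ≤ dist x y ^ (α : ℝ) := by
    intro x y
    have h1 := Real.rpow_le_rpow infDist_nonneg
      (infDist_le_infDist_add_dist (s := s) (x := x) (y := y)) α.coe_nonneg
    have h2 := Real.rpow_add_le_add_rpow (infDist_nonneg (s := s) (x := y))
      (dist_nonneg (x := x) (y := y)) α.coe_nonneg (by exact_mod_cast hα)
    linarith
  intro x _ y _
  rw [edist_dist, edist_dist, ENNReal.ofReal_rpow_of_nonneg dist_nonneg α.coe_nonneg,
    ENNReal.coe_one, one_mul]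
  refine ENNReal.ofReal_le_ofReal (abs_le.2 ⟨?_, key x y⟩)
  have := key y x
  rw [dist_comm] at this
  linarith

/-- Balls of radius `ρ` about `n` points cover at most half of the surface if `ρ` is a small
multiple of `n ^ (-1 / 2)`, so a power of the distance to the nodes, which vanishes at the nodes,
has an integral of order at least `ρ ^ α`. -/
lemma exists_le_classError {lam : ℝ} (hlam₀ : 0 < lam) (hlam₁ : lam < 1) {α : ℝ≥0} (hα₀ : 0 < α)
    (hα₁ : α ≤ 1) {c C d D : ℝ} (hc : 0 < c) (hC : 0 < C) (hd : 0 < d) (hD : 0 ≤ D) :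
    ∃ a : ℝ, 0 < a ∧ ∀ Ψ : Set (Set E3), (∀ G ∈ Ψ, IsRegularSurface c C d D G) → Ψ.Nonempty →
      ∀ n : ℕ, 1 ≤ n → ∀ (M : Set E3 → Fin n → E3) (p : Set E3 → Fin n → E3 → ℝ),
        ENNReal.ofReal (a * (n : ℝ) ^ (-(α : ℝ) / 2)) ≤ classError α lam Ψ M p := by
  obtain ⟨K, -, hK⟩ := exists_integral_kernel_le (c := c) (d := d) hlam₀ hlam₁ hC hD
  set m := c * d ^ 2 with hm
  have hm0 : 0 < m := by positivity
  -- with `ρ = r / √n` the balls about the `n` nodes have total area at most `n * C * ρ ^ 2 = m / 2`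
  set r := √(m / (2 * C)) with hr
  have hr0 : 0 < r := by positivity
  set k := 1 / ((D + 1) ^ 2) ^ lam with hkdef
  have hk0 : 0 < k := by positivity
  refine ⟨r ^ (α : ℝ) * k * (m / 2), by positivity, fun Ψ hΨ hne n hn M p => ?_⟩
  have hn0 : (0 : ℝ) < n := by exact_mod_cast hn
  obtain ⟨G, hGΨ⟩ := hne
  have hG := hΨ G hGΨ
  obtain ⟨t, ht⟩ := hG.nonempty
  have hGm := hG.isCompact.measurableSet
  set s := range (M G)
  have hs : s.Nonempty := ⟨M G ⟨0, hn⟩, mem_range_self _⟩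
  set f : E3 → ℝ := fun τ => infDist τ s ^ (α : ℝ) with hf
  have hfH : f ∈ holderClass α G := infDist_rpow_mem_holderClass hα₁ G
  refine le_trans ?_ (le_iSup₂_of_le G hGΨ (le_iSup₂_of_le f hfH (le_iSup₂_of_le t ht le_rfl)))
  refine ENNReal.ofReal_le_ofReal (le_trans ?_ (le_abs_self _))
  have hrem : remainder lam G (M G) (p G) f t = J lam G f t := by
    have : ∀ i, f (M G i) = 0 := fun i => by
      simp only [hf]
      rw [infDist_zero_of_mem (mem_range_self i), Real.zero_rpow (by exact_mod_cast hα₀.ne')]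
    simp [remainder, this]
  rw [hrem, J]
  set ρ := r / √n with hρ
  have hρ0 : 0 < ρ := by positivity
  have hρ2 : n * (C * ρ ^ 2) = m / 2 := by
    rw [hρ, div_pow, hr, Real.sq_sqrt (by positivity), Real.sq_sqrt hn0.le]
    field_simp
  set E := G \ ⋃ i, ball (M G i) ρ with hE
  have hEm : MeasurableSet E := hGm.diff (MeasurableSet.iUnion fun i => measurableSet_ball)
  have hEG : E ⊆ G := sdiff_subset
  have hEfin : areaMeasure E < ⊤ := (measure_mono hEG).trans_lt hG.area_lt_top
  have hEarea : m / 2 ≤ areaMeasure.real E := by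
    have hcover : G ⊆ E ∪ ⋃ i, G ∩ ball (M G i) ρ := by
      rw [← inter_iUnion, hE]
      exact (sdiff_union_inter G _).ge
    have hball : ∀ i, areaMeasure.real (G ∩ ball (M G i) ρ) ≤ C * ρ ^ 2 := fun i =>
      ENNReal.toReal_le_of_le_ofReal (by positivity) (hG.area_le _ _ hρ0)
    have hfin : areaMeasure (E ∪ ⋃ i, G ∩ ball (M G i) ρ) ≠ ⊤ := by
      refine ((measure_mono (union_subset hEG ?_)).trans_lt hG.area_lt_top).ne
      exact iUnion_subset fun i => inter_subset_left
    have h1 : m ≤ areaMeasure.real E + ∑ _i : Fin n, C * ρ ^ 2 :=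
      calc m ≤ area G := hG.le_area_univ hd
        _ ≤ areaMeasure.real (E ∪ ⋃ i, G ∩ ball (M G i) ρ) := measureReal_mono hcover hfin
        _ ≤ areaMeasure.real E + areaMeasure.real (⋃ i, G ∩ ball (M G i) ρ) :=
          measureReal_union_le _ _
        _ ≤ areaMeasure.real E + ∑ i, areaMeasure.real (G ∩ ball (M G i) ρ) := by
          gcongr; exact measureReal_iUnion_fintype_le _
        _ ≤ _ := by gcongr; exact hball _
    rw [Finset.sum_const, Finset.card_univ, Fintype.card_fin, nsmul_eq_mul, hρ2] at h1
    linarith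
  have hint := integrableOn_mul_kernel hα₀ hG.isCompact hfH (hK G hG t ht).1
  have hnn : ∀ τ, 0 ≤ f τ * kernel lam t τ := fun τ =>
    mul_nonneg (Real.rpow_nonneg infDist_nonneg _) (kernel_nonneg lam t τ)
  have hlow : ∀ τ ∈ E, τ ≠ t → ρ ^ (α : ℝ) * k ≤ f τ * kernel lam t τ := by
    intro τ hτ hne
    have h1 : ρ ≤ infDist τ s := by
      rw [le_infDist hs]
      rintro _ ⟨i, rfl⟩
      exact not_lt.1 fun h => hτ.2 (mem_iUnion.2 ⟨i, h⟩)
    have h2 : k ≤ kernel lam t τ := le_kernel hlam₀.le hne (by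
      linarith [(dist_le_diam_of_mem hG.isCompact.isBounded (hEG hτ) ht).trans hG.diam_le])
    exact mul_le_mul (Real.rpow_le_rpow hρ0.le h1 α.coe_nonneg) h2 hk0.le
      (Real.rpow_nonneg infDist_nonneg _)
  calc r ^ (α : ℝ) * k * (m / 2) * (n : ℝ) ^ (-(α : ℝ) / 2)
      = ρ ^ (α : ℝ) * k * (m / 2) := by rw [hρ, div_sqrt_rpow hr0.le hn0]; ring
    _ ≤ ρ ^ (α : ℝ) * k * areaMeasure.real E := by gcongr
    _ = ∫ _ in E, ρ ^ (α : ℝ) * k ∂areaMeasure := by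
        rw [setIntegral_const, smul_eq_mul, mul_comm]
    _ ≤ ∫ τ in E, f τ * kernel lam t τ ∂areaMeasure := by
        refine setIntegral_mono_on_ae (integrableOn_const hEfin.ne) (hint.mono_set hEG) hEm ?_
        filter_upwards [compl_mem_ae_iff.2 (measure_singleton (μ := areaMeasure) t)]
          with τ hτ hτE using hlow τ hτE hτ
    _ ≤ ∫ τ in G, f τ * kernel lam t τ ∂areaMeasure :=
        setIntegral_mono_set hint (ae_of_all _ hnn) hEG.eventuallyLE

end WeaklySingular

theorem theorem7p1 (α β B : ℝ≥0) (lam d D : ℝ)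
    (hα₀ : 0 < α) (hα₁ : α ≤ 1) (hβ₀ : 0 < β) (hβ₁ : β ≤ 1) (hB : 0 < B)
    (hlam₀ : 0 < lam) (hlam₁ : lam < 1) (hd : 0 < d) :
    -- areas are positive and finite, and the integrals converge
    (∀ G ∈ lyapunovClass B β d D, 0 < areaMeasure G ∧ areaMeasure G < ⊤ ∧
      ∀ f ∈ holderClass α G, ∀ t ∈ G,
        IntegrableOn (fun τ => f τ * kernel lam t τ) G areaMeasure) ∧
    -- divisions into `n` patches of comparable area exist
    (∃ c₀ : ℝ, 0 < c₀ ∧ ∀ G ∈ lyapunovClass B β d D, ∀ n : ℕ, 1 ≤ n →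
      ∃ g : Fin n → Set E3, IsDivision c₀ G g) ∧
    -- the error of the rule is of exact order `n ^ (-α / 2)`, and the rule is optimal in order
    (∀ c : ℝ, 0 < c → ∃ a A K : ℝ, 0 < a ∧ 0 < A ∧ 0 < K ∧
      ∀ Ψ₂ : Set (Set E3), Ψ₂ ⊆ lyapunovClass B β d D → Ψ₂.Nonempty →
      ∀ n : ℕ, 1 ≤ n →
      ∀ (g : Set E3 → Fin n → Set E3) (M : Set E3 → Fin n → E3),
        (∀ G ∈ Ψ₂, IsDivision c G (g G) ∧ ∀ k, M G k ∈ g G k) →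
        (ENNReal.ofReal (a * (n : ℝ) ^ (-(α : ℝ) / 2))
            ≤ classError α lam Ψ₂ M (fun G => patchWeights lam (g G)) ∧
          classError α lam Ψ₂ M (fun G => patchWeights lam (g G))
            ≤ ENNReal.ofReal (A * (n : ℝ) ^ (-(α : ℝ) / 2))) ∧
        (optimalError α lam Ψ₂ n ≤ classError α lam Ψ₂ M (fun G => patchWeights lam (g G)) ∧
          classError α lam Ψ₂ M (fun G => patchWeights lam (g G))
            ≤ ENNReal.ofReal K * optimalError α lam Ψ₂ n)) := by

  obtain ⟨c₁, C, hc₁, hC, hreg⟩ := exists_isRegularSurface B β d D hd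
  have hD := abs_nonneg D
  refine ⟨fun G hG => ?_, ⟨2 + 4 / √c₁ + |D| / (d * √c₁), by positivity, fun G hG n hn =>
    (hreg G hG).exists_isDivision hc₁ hd hn⟩, fun c hc => ?_⟩
  · have hGr := hreg G hG
    obtain ⟨K, -, hK⟩ := exists_integral_kernel_le (c := c₁) (d := d) hlam₀ hlam₁ hC hD
    refine ⟨?_, hGr.area_lt_top, fun f hf t ht =>
      integrableOn_mul_kernel hα₀ hGr.isCompact hf (hK G hGr t ht).1⟩
    refine (ENNReal.toReal_pos_iff.1 ?_).1
    exact lt_of_lt_of_le (by positivity) (hGr.le_area_univ hd)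
  · obtain ⟨a, ha, hlow⟩ := exists_le_classError hlam₀ hlam₁ hα₀ hα₁ hc₁ hC hd hD
    obtain ⟨A, hA, hup⟩ := exists_classError_le (c := c₁) (d := d) hlam₀ hlam₁ hα₀ hC hD hc
    refine ⟨a, A, A / a, ha, hA, by positivity, fun Ψ hΨ hne n hn g M hg => ?_⟩
    have hΨr := fun G hG => hreg G (hΨ hG)
    have hupper := hup Ψ hΨr n hn g M hg
    refine ⟨⟨hlow Ψ hΨr hne n hn M _, hupper⟩, ?_, ?_⟩
    · refine iInf_le_of_le M (iInf_le_of_le (fun G => patchWeights lam (g G))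
        (iInf_le_of_le (fun G hG k => ?_) le_rfl))
      exact (hg G hG).1.iUnion_eq.le (Set.mem_iUnion.2 ⟨k, (hg G hG).2 k⟩)
    · -- the lower bound holds for every formula, hence for the infimum of the errors
      have hopt : ENNReal.ofReal (a * (n : ℝ) ^ (-(α : ℝ) / 2)) ≤ optimalError α lam Ψ n :=
        le_iInf fun M => le_iInf fun p => le_iInf fun _ => hlow Ψ hΨr hne n hn M p
      calc _ ≤ ENNReal.ofReal (A * (n : ℝ) ^ (-(α : ℝ) / 2)) := hupper
        _ = ENNReal.ofReal (A / a) * ENNReal.ofReal (a * (n : ℝ) ^ (-(α : ℝ) / 2)) := by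
          rw [← ENNReal.ofReal_mul (by positivity)]
          congr 1
          field_simp
        _ ≤ _ := by gcongr
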